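/- All graphs are finite, simple, undirected and nonempty; $\log$ is the natural logarithm; $\chi(G)$ and $\omega(G)$ are the chromatic number and the clique number of $G$. For $X\subseteq V(G)$, the cut-rank $\rho_G(X)$ is the rank over $\mathbb{F}_2$ of the $0$-$1$ matrix with rows indexed by $X$ and columns indexed by $V(G)\setminus X$ whose $(u,v)$ entry is $1$ iff $uv\in E(G)$. A rank decomposition of $G$ is a finite tree $T$ with at least two nodes, all of degree $1$ or $3$, with a bijection from $V(G)$ to the leaves of $T$; its width is the maximum, over the edges $e$ of $T$, of $\rho_G(X)$, where $(X,V(G)\setminus X)$ is the partition of $V(G)$ induced by the two components of $T-e$. The rankwidth $\mathrm{rw}(G)$ is the minimum width of a rank decomposition of $G$ (and $0$ if $|V(G)|=1$). **Theorem.** For $r\in\mathbb{N}$ let $P_r$ be a real polynomial such that $\chi(G)\le P_r(\omega(G))$ for every graph $G$ with $\mathrm{rw}(G)\le r$. Then $\deg P_r=\Omega(\log r)$, and more precisely $$\deg P_r\ \ge\ \Bigl(\frac{1}{2\log 2}-o(1)\Bigr)\log r\qquad (r\to\infty).$$ The bounds are uniform in the choice of the polynomials: there are a constant $c>0$, a function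 $o:\mathbb{N}\to\mathbb{R}$ with $o(r)\to 0$ and an integer $r_0$ such that, for all $r\ge r_0$, every polynomial $P$ with $\chi(G)\le P(\omega(G))$ for all graphs $G$ with $\mathrm{rw}(G)\le r$ satisfies $\deg P\ge c\log r$ and $\deg P\ge \bigl(\frac{1}{2\log 2}-o(r)\bigr)\log r$. -/

import Mathlib

open Filter Topology Polynomial

namespace Rankwidth

open Classical in
/-- The cut-rank of `X` in `G`: the rank over the two-element field of the 0-1 matrix with rows
indexed by `X` and columns indexed by the complement of `X`, whose entries record adjacency
in `G`. (An empty matrix has rank zero.) -/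
noncomputable def cutRank {V : Type*} [Fintype V] (G : SimpleGraph V) (X : Set V) : ℕ :=
  (Matrix.of fun (i : X) (j : (Xᶜ : Set V)) =>
    if G.Adj (i : V) (j : V) then (1 : ZMod 2) else 0).rank

/-- A rank decomposition of a graph with vertex set `V`: a finite tree with at least two nodes
in which every node has degree 1 or 3, together with a bijection from `V` to its leaves. -/
structure RankDecomposition (V : Type*) where
  Node : Type
  [fintypeNode : Fintype Node]
  [nontrivialNode : Nontrivial Node]
  tree : SimpleGraph Node
  [decidableAdj : DecidableRel tree.Adj]
  isTree : tree.IsTree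
  subcubic : ∀ x, tree.degree x = 1 ∨ tree.degree x = 3
  leaf : V ≃ {x : Node // tree.degree x = 1}

namespace RankDecomposition

/-- For an edge `ab` of the tree, the vertices mapped to leaves lying in the connected component
of `a` after deletion of the edge `ab`. -/
def side {V : Type*} (D : RankDecomposition V) (a b : D.Node) : Set V :=
  {v | (D.tree.deleteEdges {s(a, b)}).Reachable a (D.leaf v : D.Node)}

/-- The width of a rank decomposition: the maximum over all edges of the tree of the cut-rank of
the bipartition induced by the edge. (Both orientations of each edge are listed; they give
complementary sides, which have the same cut-rank.) -/
noncomputable def width {V : Type*} [Fintype V] (G : SimpleGraph V)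
    (D : RankDecomposition V) : ℕ :=
  ⨆ d : D.tree.Dart, cutRank G (D.side d.fst d.snd)

end RankDecomposition

/-- The rankwidth of a finite graph: the minimum width of its rank decompositions. A graph with
at most one vertex has no rank decomposition and, by the usual convention, rankwidth zero
(this is the value of `sInf ∅` in `ℕ`). -/
noncomputable def rankwidth {V : Type*} [Fintype V] (G : SimpleGraph V) : ℕ :=
  sInf {w | ∃ D : RankDecomposition V, D.width G = w}

/-- `P` bounds the chromatic number in terms of the clique number on all finite (nonempty)
graphs of rankwidth at most `r`. -/
def IsChiBounding (r : ℕ) (P : ℝ[X]) : Prop :=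
  ∀ (V : Type) [Fintype V] [Nonempty V] (G : SimpleGraph V), rankwidth G ≤ r →
    (G.chromaticNumber.toNat : ℝ) ≤ P.eval (G.cliqueNum : ℝ)

end Rankwidth

/-! On $\mathbb{F}_2^{2m}$, join two vectors when their symplectic product is 1. Independent sets
span totally isotropic subspaces, so they have at most $2^m$ elements; cliques have at most $2m+1$;
every cut has rank at most $2m$. In lexicographic powers the clique and independence bounds
multiply, but the cuts along a balanced binary tree gain at most 1 in rank: such a cut splits a
single digit, and vertices differing at a higher digit see the whole block alike
(`rankwidth_leafPower_le`). So the $k$-th power has rankwidth at most $2m+1$ and, up to factors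
independent of $k$, $\omega\le(2m+1)^k$ and $\chi\ge 2^{mk}$. If a polynomial of degree $D$ bounds
$\chi$, letting $k\to\infty$ gives $2^m\le(2m+1)^D$ (`IsChiBounding.two_pow_le`). With $m$ about
$r/2$, $D$ is at least of order $r/\log r$, eventually above $\log r$. As $1/(2\log 2)<1$, both
bounds follow. -/

namespace Rankwidth

/-! ### Heap-ordered binary trees as rank decompositions -/

/-- The tree on `{0, …, 2 * M - 1}` in which every `i ≠ 0` is joined to its parent `i / 2`. -/
def heapTree (M : ℕ) : SimpleGraph (Fin (2 * M)) where
  Adj i j := i ≠ j ∧ ((i : ℕ) / 2 = j ∨ (j : ℕ) / 2 = i)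
  symm := ⟨fun _ _ h => ⟨h.1.symm, h.2.symm⟩⟩
  loopless := ⟨fun _ h => h.1 rfl⟩

instance (M : ℕ) : DecidableRel (heapTree M).Adj := fun i j =>
  inferInstanceAs (Decidable (i ≠ j ∧ ((i : ℕ) / 2 = j ∨ (j : ℕ) / 2 = i)))

/-- `j` is `i` or lies below `i` in the heap order. -/
def IsDescendant (i j : ℕ) : Prop := ∃ n, j / 2 ^ n = i

theorem isDescendant_half_iff {i j : ℕ} (h : j ≠ i) : IsDescendant i (j / 2) ↔ IsDescendant i j := by
  constructor
  · rintro ⟨n, hn⟩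
    exact ⟨n + 1, by rw [pow_succ', ← Nat.div_div_eq_div_mul, hn]⟩
  · rintro ⟨n, hn⟩
    cases n with
    | zero => simp at hn; exact absurd hn h
    | succ n => exact ⟨n, by rw [← hn, pow_succ', ← Nat.div_div_eq_div_mul]⟩

theorem not_isDescendant_half {i : ℕ} (hi : i ≠ 0) : ¬ IsDescendant i (i / 2) := by
  rintro ⟨n, hn⟩
  have := Nat.div_le_self (i / 2) (2 ^ n)
  omega

theorem not_isDescendant_zero {i : ℕ} (hi : i ≠ 0) : ¬ IsDescendant i 0 := by
  rintro ⟨n, hn⟩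
  simp at hn
  omega

variable {M : ℕ}

theorem heapTree_adj_iff {i j : Fin (2 * M)} : (heapTree M).Adj i j ↔
    (i : ℕ) ≠ j ∧ ((i : ℕ) / 2 = j ∨ (j : ℕ) / 2 = i) := by
  simp [heapTree, Fin.ext_iff]

/-- The parent of a node of the heap tree. -/
def parent (j : Fin (2 * M)) : Fin (2 * M) := ⟨j / 2, by omega⟩

theorem heapTree_adj_parent {j : Fin (2 * M)} (hj : (j : ℕ) ≠ 0) :
    (heapTree M).Adj j (parent j) := by
  refine ⟨fun h => ?_, Or.inl rfl⟩
  have := congrArg Fin.val h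
  simp only [parent] at this
  omega

theorem deleteEdges_adj_parent {i j : Fin (2 * M)} (hj : (j : ℕ) ≠ 0) (hij : j ≠ i) :
    ((heapTree M).deleteEdges {s(i, parent i)}).Adj j (parent j) := by
  rw [SimpleGraph.deleteEdges_adj]
  refine ⟨heapTree_adj_parent hj, ?_⟩
  rw [Set.mem_singleton_iff, Sym2.eq_iff]
  rintro (⟨h, -⟩ | ⟨h1, h2⟩)
  · exact hij h
  · have h1 := congrArg Fin.val h1
    have h2 := congrArg Fin.val h2
    simp only [parent] at h1 h2
    omega

/-- Halving preserves being below `i` except at `i` itself, so the deleted edge is the only one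
leaving the subtree of `i`. -/
theorem isDescendant_iff_of_reachable {i j l : Fin (2 * M)}
    (h : ((heapTree M).deleteEdges {s(i, parent i)}).Reachable j l) :
    IsDescendant i j ↔ IsDescendant i l := by
  obtain ⟨w⟩ := h
  induction w with
  | nil => rfl
  | @cons u v w h _ ih =>
    rw [← ih]
    rw [SimpleGraph.deleteEdges_adj, Set.mem_singleton_iff] at h
    obtain ⟨⟨hne, h | h⟩, hs⟩ := h
    · rw [← h, isDescendant_half_iff]
      intro hu
      have hu : u = i := Fin.ext hu
      subst hu
      exact hs (by congr 2; exact Fin.ext h.symm)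
    · rw [← h, isDescendant_half_iff]
      intro hv
      have hv : v = i := Fin.ext hv
      subst hv
      exact hs (by rw [Sym2.eq_swap]; congr 2; exact Fin.ext h.symm)

theorem reachable_of_isDescendant {i j : Fin (2 * M)} (hi : (i : ℕ) ≠ 0) (h : IsDescendant i j) :
    ((heapTree M).deleteEdges {s(i, parent i)}).Reachable i j := by
  induction hk : (j : ℕ) using Nat.strong_induction_on generalizing j with
  | _ k ih =>
    subst hk
    by_cases hij : j = i
    · rw [hij]
    · have hj : (j : ℕ) ≠ 0 := fun h0 => not_isDescendant_zero hi (h0 ▸ h)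
      have hp : IsDescendant i (parent j) :=
        (isDescendant_half_iff fun e => hij (Fin.ext e)).2 h
      exact (ih (parent j) (by simp only [parent]; omega) hp rfl).trans
        (deleteEdges_adj_parent hj hij).symm.reachable

theorem reachable_root {i j l : Fin (2 * M)} (hl : (l : ℕ) = 0) (h : ¬ IsDescendant i j) :
    ((heapTree M).deleteEdges {s(i, parent i)}).Reachable j l := by
  induction hk : (j : ℕ) using Nat.strong_induction_on generalizing j with
  | _ k ih =>
    subst hk
    by_cases hj : (j : ℕ) = 0
    · rw [Fin.ext (hj.trans hl.symm)]
    · have hij : j ≠ i := fun e => h (e ▸ ⟨0, by simp⟩)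
      have hp : ¬ IsDescendant i (parent j) := fun hp =>
        h ((isDescendant_half_iff fun e => hij (Fin.ext e)).1 hp)
      exact (deleteEdges_adj_parent hj hij).reachable.trans
        (ih (parent j) (by simp only [parent]; omega) hp rfl)

theorem reachable_iff_isDescendant {i j : Fin (2 * M)} (hi : (i : ℕ) ≠ 0) :
    ((heapTree M).deleteEdges {s(i, parent i)}).Reachable i j ↔ IsDescendant i j :=
  ⟨fun h => (isDescendant_iff_of_reachable h).1 ⟨0, by simp⟩, reachable_of_isDescendant hi⟩

theorem reachable_parent_iff_not_isDescendant {i j : Fin (2 * M)} (hi : (i : ℕ) ≠ 0) :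
    ((heapTree M).deleteEdges {s(i, parent i)}).Reachable (parent i) j ↔ ¬ IsDescendant i j := by
  have hp : ¬ IsDescendant i (parent i) := not_isDescendant_half hi
  refine ⟨fun h hd => hp ((isDescendant_iff_of_reachable h).2 hd), fun h => ?_⟩
  have hl : (0 : ℕ) < 2 * M := by omega
  exact (reachable_root (l := ⟨0, hl⟩) rfl hp).trans (reachable_root (l := ⟨0, hl⟩) rfl h).symm

theorem heapTree_adj_cases {i j : Fin (2 * M)} (h : (heapTree M).Adj i j) :
    ((i : ℕ) ≠ 0 ∧ j = parent i) ∨ ((j : ℕ) ≠ 0 ∧ i = parent j) := by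
  obtain ⟨hne, h | h⟩ := h
  · refine Or.inl ⟨fun h0 => hne (Fin.ext ?_), Fin.ext h.symm⟩
    omega
  · refine Or.inr ⟨fun h0 => hne (Fin.ext ?_), Fin.ext h.symm⟩
    omega

theorem heapTree_isTree (hM : 0 < M) : (heapTree M).IsTree := by
  have hl : (0 : ℕ) < 2 * M := by omega
  have key : ∀ j, (heapTree M).Reachable j ⟨0, hl⟩ := fun j =>  by
    by_cases hj : (j : ℕ) = 0
    · rw [show j = ⟨0, hl⟩ from Fin.ext hj]
    · have hr := reachable_root (i := j) (j := parent j) (l := ⟨0, hl⟩) rfl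
        (not_isDescendant_half hj)
      exact (heapTree_adj_parent hj).reachable.trans (hr.mono (SimpleGraph.deleteEdges_le _))
  have : Nonempty (Fin (2 * M)) := ⟨⟨0, hl⟩⟩
  refine ⟨⟨fun i j => (key i).trans (key j).symm⟩, ?_⟩
  rw [SimpleGraph.isAcyclic_iff_forall_adj_isBridge]
  have hb : ∀ i : Fin (2 * M), (i : ℕ) ≠ 0 → (heapTree M).IsBridge s(i, parent i) := fun i hi => by
    rw [SimpleGraph.isBridge_iff]
    exact fun h => not_isDescendant_half hi ((reachable_iff_isDescendant hi).1 h)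
  intro i j h
  obtain ⟨hi, rfl⟩ | ⟨hj, rfl⟩ := heapTree_adj_cases h
  · exact hb _ hi
  · rw [Sym2.eq_swap]
    exact hb _ hj

theorem heapTree_degree_of_leaf {i : Fin (2 * M)} (hi : (i : ℕ) = 0 ∨ M ≤ i) :
    (heapTree M).degree i = 1 := by
  rw [← SimpleGraph.card_neighborFinset_eq_degree, Finset.card_eq_one]
  by_cases h0 : (i : ℕ) = 0
  -- The root 0 is its own half, so its only neighbour is 1, making it an extra leaf.
  · refine ⟨⟨1, by omega⟩, ?_⟩
    ext j
    simp only [SimpleGraph.mem_neighborFinset, heapTree_adj_iff, Finset.mem_singleton, Fin.ext_iff]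
    omega
  · refine ⟨parent i, ?_⟩
    ext j
    simp only [SimpleGraph.mem_neighborFinset, heapTree_adj_iff, Finset.mem_singleton, Fin.ext_iff,
      parent]
    omega

theorem heapTree_degree_of_inner {i : Fin (2 * M)} (h0 : (i : ℕ) ≠ 0) (hi : (i : ℕ) < M) :
    (heapTree M).degree i = 3 := by
  rw [← SimpleGraph.card_neighborFinset_eq_degree, Finset.card_eq_three]
  refine ⟨parent i, ⟨2 * i, by omega⟩, ⟨2 * i + 1, by omega⟩, ?_, ?_, ?_, ?_⟩
  · simp only [parent, ne_eq, Fin.ext_iff]; omega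
  · simp only [parent, ne_eq, Fin.ext_iff]; omega
  · simp only [ne_eq, Fin.ext_iff]; omega
  · ext j
    simp only [SimpleGraph.mem_neighborFinset, heapTree_adj_iff, Finset.mem_singleton, Fin.ext_iff,
      parent, Finset.mem_insert]
    omega

theorem heapTree_degree_eq_one_iff {i : Fin (2 * M)} :
    (heapTree M).degree i = 1 ↔ (i : ℕ) = 0 ∨ M ≤ i := by
  refine ⟨fun h => ?_, heapTree_degree_of_leaf⟩
  by_contra! hc
  rw [heapTree_degree_of_inner hc.1 hc.2] at h
  omega

/-- The leaves of the heap tree: the root `0` and the nodes from `M` on. -/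
abbrev HeapLeaf (M : ℕ) : Type := {i : Fin (2 * M) // (heapTree M).degree i = 1}

/-- The heap tree as a rank decomposition of graphs on its own leaves. -/
def heapDecomposition (hM : 0 < M) : RankDecomposition (HeapLeaf M) where
  Node := Fin (2 * M)
  nontrivialNode := Fin.nontrivial_iff_two_le.2 (by omega)
  tree := heapTree M
  isTree := heapTree_isTree hM
  subcubic i := by
    by_cases h : (i : ℕ) = 0 ∨ M ≤ i
    · exact Or.inl (heapTree_degree_of_leaf h)
    · push Not at h
      exact Or.inr (heapTree_degree_of_inner h.1 h.2)
  leaf := Equiv.refl _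

/-- Each edge joins some `i ≠ 0` to its parent; its two orientations give the leaves below `i` and
their complement. -/
theorem rankwidth_heapLeaf_le (hM : 0 < M) (G : SimpleGraph (HeapLeaf M)) {s : ℕ}
    (h : ∀ i : ℕ, i ≠ 0 → cutRank G {v | IsDescendant i v.1} ≤ s ∧
      cutRank G {v | IsDescendant i v.1}ᶜ ≤ s) : rankwidth G ≤ s := by
  have key : ∀ i j, (heapTree M).Adj i j → cutRank G ((heapDecomposition hM).side i j) ≤ s := by
    intro i j hij
    obtain ⟨hi, rfl⟩ | ⟨hj, rfl⟩ := heapTree_adj_cases hij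
    · have hs : (heapDecomposition hM).side i (parent i) = {v | IsDescendant i v.1} := by
        ext v
        exact reachable_iff_isDescendant hi
      rw [hs]
      exact (h i hi).1
    · have hs : (heapDecomposition hM).side (parent j) j = {v | IsDescendant j v.1}ᶜ := by
        ext v
        have := reachable_parent_iff_not_isDescendant (j := v.1) hj
        rw [Sym2.eq_swap] at this
        exact this
      rw [hs]
      exact (h j hj).2
  have hw : (heapDecomposition hM).width G ≤ s := ciSup_le' fun d => key _ _ d.adj
  have hmem : (heapDecomposition hM).width G ∈
      {w | ∃ D : RankDecomposition (HeapLeaf M), D.width G = w} := ⟨_, rfl⟩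
  exact (Nat.sInf_le hmem).trans hw

end Rankwidth

/-! ### Cut-rank and lexicographic powers -/

namespace Rankwidth
open scoped Matrix

/-- The cut matrix factors through $\mathbb{F}_2^\iota$. -/
theorem cutRank_le_card {V ι : Type*} [Fintype V] [Fintype ι] (G : SimpleGraph V) (X : Set V)
    (f g : V → ι → ZMod 2) (h : ∀ x ∈ X, ∀ y ∉ X, (G.Adj x y ↔ f x ⬝ᵥ g y = 1)) :
    cutRank G X ≤ Fintype.card ι := by
  classical
  have hz : ∀ a : ZMod 2, a ≠ 1 → a = 0 := by decide
  have e : (Matrix.of fun (i : X) (j : (Xᶜ : Set V)) =>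
      if G.Adj (i : V) (j : V) then (1 : ZMod 2) else 0) =
      (Matrix.of fun (i : X) => f i) * (Matrix.of fun (k : ι) (j : (Xᶜ : Set V)) => g j k) := by
    ext i j
    have hij := h i i.2 j j.2
    change _ = f i ⬝ᵥ g j
    by_cases ha : G.Adj (i : V) (j : V)
    · simp [ha, hij.1 ha]
    · simp [ha, hz _ fun e => ha (hij.2 e)]
  unfold cutRank
  refine le_trans (le_of_eq ?_) ((Matrix.rank_mul_le_left (Matrix.of fun (i : X) => f i)
    (Matrix.of fun (k : ι) (j : (Xᶜ : Set V)) => g j k)).trans (Matrix.rank_le_card_width _))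
  rw [← e]

/-- The infinite lexicographic power of a graph on the base-`q` digits: two numbers are adjacent
if their digits at the highest position where they differ are adjacent in `G`. -/
def lexPower (G : SimpleGraph ℕ) (q : ℕ) : SimpleGraph ℕ where
  Adj u v := ∃ t, u / q ^ (t + 1) = v / q ^ (t + 1) ∧ G.Adj (u / q ^ t % q) (v / q ^ t % q)
  symm := ⟨fun _ _ ⟨t, h, h'⟩ => ⟨t, h.symm, h'.symm⟩⟩
  loopless := ⟨fun _ ⟨_, _, h⟩ => G.irrefl h⟩

theorem div_pow_eq_of_le {q t t' u v : ℕ} (htt : t ≤ t') (h : u / q ^ t = v / q ^ t) :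
    u / q ^ t' = v / q ^ t' := by
  obtain ⟨k, rfl⟩ := Nat.exists_eq_add_of_le htt
  rw [pow_add, ← Nat.div_div_eq_div_mul, ← Nat.div_div_eq_div_mul, h]

theorem lexPower_adj_iff {G : SimpleGraph ℕ} {q t u v : ℕ}
    (h : u / q ^ (t + 1) = v / q ^ (t + 1)) (h' : u / q ^ t ≠ v / q ^ t) :
    (lexPower G q).Adj u v ↔ G.Adj (u / q ^ t % q) (v / q ^ t % q) := by
  refine ⟨fun ⟨t', he, ha⟩ => ?_, fun ha => ⟨t, h, ha⟩⟩
  rcases lt_trichotomy t t' with hlt | rfl | hlt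
  · rw [div_pow_eq_of_le hlt h] at ha
    exact absurd ha (G.irrefl)
  · exact ha
  · exact absurd (div_pow_eq_of_le hlt he) h'

/-- Numbers agreeing from digit `t` on form a module: an outside vertex first differs from all of
them at the same digit. -/
theorem lexPower_adj_congr_left {G : SimpleGraph ℕ} {q t u u' v : ℕ}
    (hu : u / q ^ t = u' / q ^ t) (hv : u / q ^ t ≠ v / q ^ t) :
    (lexPower G q).Adj u v ↔ (lexPower G q).Adj u' v := by
  have key : ∀ {a b : ℕ}, a / q ^ t = b / q ^ t → a / q ^ t ≠ v / q ^ t →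
      (lexPower G q).Adj a v → (lexPower G q).Adj b v := by
    rintro a b hab hav ⟨s, he, ha⟩
    have hts : t ≤ s := by
      by_contra! hlt
      exact hav (div_pow_eq_of_le hlt he)
    refine ⟨s, ?_, ?_⟩
    · rw [← div_pow_eq_of_le (hts.trans s.le_succ) hab, he]
    · rwa [← div_pow_eq_of_le hts hab]
  exact ⟨key hu hv, key hu.symm (hu ▸ hv)⟩

/-- If the sets of digits that are pairwise related by `R` have at most `a` elements, then the sets
of numbers with `t` digits that are pairwise related by `R` at the highest position where
they differ have at most `a ^ t` elements. -/
theorem card_le_pow_of_digits {q a : ℕ} (hq : 0 < q) {R : ℕ → ℕ → Prop}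
    (hR : ∀ T : Finset ℕ, (∀ x ∈ T, x < q) → (T : Set ℕ).Pairwise R → T.card ≤ a) (t : ℕ)
    (S : Finset ℕ) (hS : ∀ x ∈ S, ∀ y ∈ S, x / q ^ t = y / q ^ t)
    (hSR : ∀ x ∈ S, ∀ y ∈ S, ∀ s, x / q ^ (s + 1) = y / q ^ (s + 1) → x / q ^ s ≠ y / q ^ s →
      R (x / q ^ s % q) (y / q ^ s % q)) : S.card ≤ a ^ t := by
  induction t generalizing S with
  | zero =>
    rw [pow_zero, Finset.card_le_one]
    simpa using hS
  | succ t ih =>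
    have hT : (S.image fun x => x / q ^ t % q).card ≤ a := by
      refine hR _ ?_ ?_
      · simp only [Finset.mem_image, forall_exists_index, and_imp]
        rintro _ x - rfl
        exact Nat.mod_lt _ hq
      · intro u hu v hv huv
        simp only [Finset.coe_image, Set.mem_image, Finset.mem_coe] at hu hv
        obtain ⟨x, hx, rfl⟩ := hu
        obtain ⟨y, hy, rfl⟩ := hv
        exact hSR x hx y hy t (hS x hx y hy) fun e => huv (by rw [e])
    -- Split by digit `t`: at most `a` values occur, and each fibre agrees from digit `t` on, so
    -- induction applies to it.
    refine (Finset.card_le_mul_card_image (f := fun x => x / q ^ t % q) S (a ^ t) ?_).trans ?_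
    · intro b _
      refine ih _ ?_ ?_
      · intro x hx y hy
        rw [Finset.mem_filter] at hx hy
        have h1 := hS x hx.1 y hy.1
        rw [pow_succ, ← Nat.div_div_eq_div_mul, ← Nat.div_div_eq_div_mul] at h1
        rw [← Nat.div_add_mod (x / q ^ t) q, ← Nat.div_add_mod (y / q ^ t) q, h1, hx.2, hy.2]
      · intro x hx y hy
        exact hSR x (Finset.mem_filter.1 hx).1 y (Finset.mem_filter.1 hy).1
    · rw [pow_succ]
      exact Nat.mul_le_mul_left _ hT

theorem lexPower_clique_card_le {G : SimpleGraph ℕ} {q a : ℕ} (hq : 0 < q)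
    (hG : ∀ T : Finset ℕ, (∀ x ∈ T, x < q) → (T : Set ℕ).Pairwise G.Adj → T.card ≤ a) {t : ℕ}
    (S : Finset ℕ) (hS : ∀ x ∈ S, x < q ^ t) (hc : (S : Set ℕ).Pairwise (lexPower G q).Adj) :
    S.card ≤ a ^ t := by
  refine card_le_pow_of_digits hq hG t S ?_ ?_
  · intro x hx y hy
    rw [Nat.div_eq_of_lt (hS x hx), Nat.div_eq_of_lt (hS y hy)]
  · intro x hx y hy s h h'
    exact (lexPower_adj_iff h h').1 (hc hx hy fun e => h' (by rw [e]))

theorem lexPower_indep_card_le {G : SimpleGraph ℕ} {q a : ℕ} (hq : 0 < q)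
    (hG : ∀ T : Finset ℕ, (∀ x ∈ T, x < q) → (T : Set ℕ).Pairwise (fun x y => ¬ G.Adj x y) →
      T.card ≤ a) {t : ℕ} (S : Finset ℕ) (hS : ∀ x ∈ S, x < q ^ t)
    (hc : (S : Set ℕ).Pairwise (fun x y => ¬ (lexPower G q).Adj x y)) : S.card ≤ a ^ t := by
  refine card_le_pow_of_digits hq hG t S ?_ ?_
  · intro x hx y hy
    rw [Nat.div_eq_of_lt (hS x hx), Nat.div_eq_of_lt (hS y hy)]
  · intro x hx y hy s h h'
    exact fun ha => hc hx hy (fun e => h' (by rw [e])) ((lexPower_adj_iff h h').2 ha)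

/-! ### Rankwidth of lexicographic powers -/

theorem heapLeaf_eq_zero_or_le {M : ℕ} (v : HeapLeaf M) : (v.1 : ℕ) = 0 ∨ M ≤ v.1 :=
  heapTree_degree_eq_one_iff.1 v.2

/-- The descendants among the leaves of a given node lie at the same distance below it. -/
theorem exists_div_two_pow_eq_of_isDescendant {i : ℕ} (hi : i ≠ 0) (N : ℕ) :
    ∃ s, ∀ v : HeapLeaf (2 ^ N), IsDescendant i v.1 ↔ (v.1 : ℕ) / 2 ^ s = i := by
  refine ⟨N - Nat.log 2 i, fun v => ⟨?_, fun h => ⟨_, h⟩⟩⟩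
  rintro ⟨n, hn⟩
  have h0 : (v.1 : ℕ) ≠ 0 := fun h => hi (by rw [← hn, h, Nat.zero_div])
  have hM := (heapLeaf_eq_zero_or_le v).resolve_left h0
  have hlog : Nat.log 2 (v.1 : ℕ) = N := by
    rw [Nat.log_eq_iff (Or.inr ⟨one_lt_two, h0⟩)]
    refine ⟨hM, ?_⟩
    have := v.1.2
    rw [pow_succ']
    exact this
  have hn2 : n ≤ N := by
    rw [← hlog]
    refine Nat.le_log_of_pow_le one_lt_two ?_
    by_contra! hlt
    exact hi (by rw [← hn, Nat.div_eq_of_lt hlt])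
  have hl : Nat.log 2 i = N - n := by
    rw [← hn, Nat.log_div_base_pow, hlog]
  rw [hl, Nat.sub_sub_self hn2, hn]

/-- The lexicographic power of `G` in base `q` on the leaves of the heap tree. -/
def leafPower (G : SimpleGraph ℕ) (q M : ℕ) : SimpleGraph (HeapLeaf M) :=
  (lexPower G q).comap fun v => (v.1 : ℕ)

theorem rankwidth_leafPower_le {ι : Type*} [Fintype ι] {G : SimpleGraph ℕ}
    (F H : ℕ → ι → ZMod 2) (hFH : ∀ a b, G.Adj a b ↔ F a ⬝ᵥ H b = 1) {d : ℕ} (hd : 0 < d)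
    (N : ℕ) : rankwidth (leafPower G (2 ^ d) (2 ^ N)) ≤ Fintype.card ι + 1 := by
  classical
  refine rankwidth_heapLeaf_le (by positivity) _ fun i hi => ?_
  obtain ⟨s, hs⟩ := exists_div_two_pow_eq_of_isDescendant hi N
  set q := 2 ^ d with hq
  -- Bit `s` lies in digit `t`. The block below `i`, represented by `x₀`, is constant above that
  -- digit. An outside vertex agreeing with it there is decided by digit `t`, through `F` and `H`;
  -- any other is uniform on the block and uses the one extra coordinate.
  set t := s / d with ht
  set x₀ := i * 2 ^ s with hx0
  let f : HeapLeaf (2 ^ N) → ι ⊕ Unit → ZMod 2 := fun x =>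
    Sum.elim (F ((x.1 : ℕ) / q ^ t % q)) 1
  let g : HeapLeaf (2 ^ N) → ι ⊕ Unit → ZMod 2 := fun y =>
    if (y.1 : ℕ) / q ^ (t + 1) = x₀ / q ^ (t + 1) then Sum.elim (H ((y.1 : ℕ) / q ^ t % q)) 0
    else Sum.elim 0 (fun _ => if (lexPower G q).Adj x₀ y.1 then 1 else 0)
  have hlow : ∀ {a b : ℕ}, a / q ^ t = b / q ^ t → a / 2 ^ s = b / 2 ^ s := fun {a b} h => by
    rw [hq, ← pow_mul] at h
    exact div_pow_eq_of_le (by rw [ht, mul_comm]; exact Nat.div_mul_le_self s d) h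
  have hhigh : ∀ {a b : ℕ}, a / 2 ^ s = b / 2 ^ s → a / q ^ (t + 1) = b / q ^ (t + 1) :=
      fun {a b} h => by
    rw [hq, ← pow_mul]
    exact div_pow_eq_of_le (Nat.lt_mul_div_succ s hd).le h
  have hx0' : x₀ / 2 ^ s = i := Nat.mul_div_cancel _ (by positivity)
  have key : ∀ x y, IsDescendant i x.1 → ¬ IsDescendant i y.1 →
      ((leafPower G q (2 ^ N)).Adj x y ↔ f x ⬝ᵥ g y = 1) := by
    intro x y hx hy
    rw [hs] at hx hy
    have hxx : (x.1 : ℕ) / q ^ (t + 1) = x₀ / q ^ (t + 1) := hhigh (hx.trans hx0'.symm)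
    change (lexPower G q).Adj x.1 y.1 ↔ _
    by_cases hc : (y.1 : ℕ) / q ^ (t + 1) = x₀ / q ^ (t + 1)
    · rw [lexPower_adj_iff (hxx.trans hc.symm) fun e => hy ((hlow e).symm.trans hx), hFH]
      simp [f, g, hc, dotProduct, Fintype.sum_sum_type]
    · rw [lexPower_adj_congr_left hxx fun e => hc (e.symm.trans hxx)]
      simp [f, g, hc, dotProduct, Fintype.sum_sum_type]
  have hcard : Fintype.card (ι ⊕ Unit) = Fintype.card ι + 1 := by simp
  rw [← hcard]
  refine ⟨cutRank_le_card _ _ f g fun x hx y hy => key x y hx hy,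
    cutRank_le_card _ _ g f fun x hx y hy => ?_⟩
  rw [SimpleGraph.adj_comm, dotProduct_comm]
  exact key y x (not_not.1 hy) hx

end Rankwidth

/-! ### The symplectic graph -/

namespace Rankwidth
open scoped Matrix

/-- The vector of the binary digits of `n` at the positions `k, …, k + m - 1`. -/
def bitVec (m k n : ℕ) : Fin m → ZMod 2 := fun i => if n.testBit (k + i) then 1 else 0

/-- The standard symplectic form on `𝔽₂^m × 𝔽₂^m`. -/
def sympForm (m : ℕ) : LinearMap.BilinForm (ZMod 2) ((Fin m → ZMod 2) × (Fin m → ZMod 2)) :=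
  LinearMap.mk₂ (ZMod 2) (fun u v => u.1 ⬝ᵥ v.2 + u.2 ⬝ᵥ v.1)
    (fun u u' v => by simp only [Prod.fst_add, Prod.snd_add, add_dotProduct]; ring)
    (fun c u v => by simp only [Prod.smul_fst, Prod.smul_snd, smul_dotProduct, smul_add])
    (fun u v v' => by simp only [Prod.fst_add, Prod.snd_add, dotProduct_add]; ring)
    (fun c u v => by simp only [Prod.smul_fst, Prod.smul_snd, dotProduct_smul, smul_add])

variable {m : ℕ}

theorem sympForm_apply (u v : (Fin m → ZMod 2) × (Fin m → ZMod 2)) :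
    sympForm m u v = u.1 ⬝ᵥ v.2 + u.2 ⬝ᵥ v.1 := rfl

theorem sympForm_comm (u v : (Fin m → ZMod 2) × (Fin m → ZMod 2)) :
    sympForm m u v = sympForm m v u := by
  rw [sympForm_apply, sympForm_apply, dotProduct_comm u.1, dotProduct_comm u.2, add_comm]

theorem sympForm_self (u : (Fin m → ZMod 2) × (Fin m → ZMod 2)) : sympForm m u u = 0 := by
  rw [sympForm_apply, dotProduct_comm u.2, CharTwo.add_self_eq_zero]

theorem sympForm_separatingLeft (u : (Fin m → ZMod 2) × (Fin m → ZMod 2))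
    (h : ∀ v, sympForm m u v = 0) : u = 0 := by
  ext i
  · simpa [sympForm_apply] using h (0, Pi.single i 1)
  · simpa [sympForm_apply] using h (Pi.single i 1, 0)

theorem sympForm_nondegenerate : (sympForm m).Nondegenerate :=
  ⟨fun u h => sympForm_separatingLeft u h,
    fun u h => sympForm_separatingLeft u fun v => (sympForm_comm u v).trans (h v)⟩

theorem finrank_prod_pi : Module.finrank (ZMod 2) ((Fin m → ZMod 2) × (Fin m → ZMod 2)) = 2 * m := by
  simp [two_mul]

/-- The span $W$ satisfies $W\le W^\perp$, hence $2\dim W\le 2m$. -/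
theorem card_le_of_isotropic (S : Finset ((Fin m → ZMod 2) × (Fin m → ZMod 2)))
    (hS : ∀ u ∈ S, ∀ v ∈ S, sympForm m u v = 0) : S.card ≤ 2 ^ m := by
  classical
  let W := Submodule.span (ZMod 2) (S : Set ((Fin m → ZMod 2) × (Fin m → ZMod 2)))
  have hW : W ≤ (sympForm m).orthogonal W := by
    refine Submodule.span_le.2 fun v hv => ?_
    rw [SetLike.mem_coe, LinearMap.BilinForm.mem_orthogonal_iff]
    intro u hu
    change sympForm m u v = 0
    induction hu using Submodule.span_induction with
    | mem u hu => exact hS u hu v hv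
    | zero => simp
    | add u u' _ _ h h' => simp [h, h']
    | smul c u _ h => simp [h]
  have hfin := Submodule.finrank_mono hW
  rw [LinearMap.BilinForm.finrank_orthogonal sympForm_nondegenerate, finrank_prod_pi] at hfin
  have hcard : Nat.card W = 2 ^ Module.finrank (ZMod 2) W := by
    have := Module.natCard_eq_pow_finrank (K := ZMod 2) (V := W)
    simpa using this
  calc S.card = Nat.card (S : Set ((Fin m → ZMod 2) × (Fin m → ZMod 2))) := by simp
    _ ≤ Nat.card W := Nat.card_mono (Set.toFinite _) Submodule.subset_span
    _ ≤ 2 ^ m := by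
      rw [hcard]
      exact Nat.pow_le_pow_right two_pos (by omega)

/-- Without one element `z` the set is linearly independent: pairing a relation with `z` gives
$\sum_i a_i=0$, pairing it with the `j`-th vector gives $\sum_{i\ne j}a_i=0$, so $a_j=0$. -/
theorem card_le_of_pairwise_eq_one (S : Finset ((Fin m → ZMod 2) × (Fin m → ZMod 2)))
    (hS : ∀ u ∈ S, ∀ v ∈ S, u ≠ v → sympForm m u v = 1) : S.card ≤ 2 * m + 1 := by
  classical
  obtain rfl | ⟨z, hz⟩ := S.eq_empty_or_nonempty
  · simp
  have hli : LinearIndependent (ZMod 2)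
      (Subtype.val : (S.erase z) → (Fin m → ZMod 2) × (Fin m → ZMod 2)) := by
    rw [Fintype.linearIndependent_iff]
    intro a ha j
    have hform : ∀ v, ∑ i, a i * sympForm m i.1 v = 0 := fun v => by
      have := congrArg (fun u => sympForm m u v) ha
      simpa [map_sum, LinearMap.sum_apply] using this
    have hz0 : ∑ i, a i = 0 := by
      rw [← hform z]
      refine Finset.sum_congr rfl fun i _ => ?_
      rw [hS i (Finset.mem_of_mem_erase i.2) z hz (Finset.ne_of_mem_erase i.2), mul_one]
    have hj := hform j
    rw [← Finset.add_sum_erase _ _ (Finset.mem_univ j), sympForm_self, mul_zero, zero_add] at hj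
    rw [← Finset.add_sum_erase _ _ (Finset.mem_univ j)] at hz0
    rw [← hz0, left_eq_add, ← hj]
    refine Finset.sum_congr rfl fun i hi => ?_
    rw [hS i (Finset.mem_of_mem_erase i.2) j (Finset.mem_of_mem_erase j.2), mul_one]
    exact fun e => Finset.ne_of_mem_erase hi (Subtype.ext e)
  have := hli.fintype_card_le_finrank
  rw [finrank_prod_pi, Fintype.card_coe, Finset.card_erase_of_mem hz] at this
  omega

/-- The vector of the `2 * m` lowest binary digits of `n`. -/
def bitPair (m n : ℕ) : (Fin m → ZMod 2) × (Fin m → ZMod 2) := (bitVec m 0 n, bitVec m m n)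

theorem bitPair_injOn {a b : ℕ} (ha : a < 2 ^ (2 * m)) (hb : b < 2 ^ (2 * m))
    (h : bitPair m a = bitPair m b) : a = b := by
  have hbit : ∀ (k : ℕ) (i : Fin m), bitVec m k a i = bitVec m k b i →
      a.testBit (k + i) = b.testBit (k + i) := by
    intro k i h
    unfold bitVec at h
    split_ifs at h with h1 h2 h2 <;> simp_all
  have h1 := congrArg Prod.fst h
  have h2 := congrArg Prod.snd h
  refine Nat.eq_of_testBit_eq fun i => ?_
  rcases lt_or_ge i m with hi | hi
  · simpa using hbit 0 ⟨i, hi⟩ (congrFun h1 _)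
  rcases lt_or_ge i (2 * m) with hi' | hi'
  · have := hbit m ⟨i - m, by omega⟩ (congrFun h2 _)
    simpa [Nat.add_sub_cancel' hi] using this
  · rw [Nat.testBit_lt_two_pow (ha.trans_le (Nat.pow_le_pow_right two_pos hi')),
      Nat.testBit_lt_two_pow (hb.trans_le (Nat.pow_le_pow_right two_pos hi'))]

/-- The graph of non-orthogonality with respect to the symplectic form. -/
def sympGraph (m : ℕ) : SimpleGraph ℕ where
  Adj a b := sympForm m (bitPair m a) (bitPair m b) = 1
  symm := ⟨fun _ _ h => (sympForm_comm _ _).trans h⟩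
  loopless := ⟨fun a h => by rw [sympForm_self] at h; exact zero_ne_one h⟩

theorem sympGraph_adj_iff_dotProduct (a b : ℕ) : (sympGraph m).Adj a b ↔
    Sum.elim (bitPair m a).1 (bitPair m a).2 ⬝ᵥ Sum.elim (bitPair m b).2 (bitPair m b).1 = 1 := by
  rw [sumElim_dotProduct_sumElim]
  rfl

theorem sympGraph_clique_card_le (T : Finset ℕ) (hT : ∀ x ∈ T, x < 2 ^ (2 * m))
    (h : (T : Set ℕ).Pairwise (sympGraph m).Adj) : T.card ≤ 2 * m + 1 := by
  classical
  rw [← Finset.card_image_of_injOn (f := bitPair m)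
    fun a ha b hb => bitPair_injOn (hT a ha) (hT b hb)]
  refine card_le_of_pairwise_eq_one _ ?_
  simp only [Finset.mem_image]
  rintro _ ⟨a, ha, rfl⟩ _ ⟨b, hb, rfl⟩ hab
  exact h ha hb fun e => hab (by rw [e])

theorem sympGraph_indep_card_le (T : Finset ℕ) (hT : ∀ x ∈ T, x < 2 ^ (2 * m))
    (h : (T : Set ℕ).Pairwise fun x y => ¬ (sympGraph m).Adj x y) : T.card ≤ 2 ^ m := by
  classical
  have hz : ∀ a : ZMod 2, a ≠ 1 → a = 0 := by decide
  rw [← Finset.card_image_of_injOn (f := bitPair m)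
    fun a ha b hb => bitPair_injOn (hT a ha) (hT b hb)]
  refine card_le_of_isotropic _ ?_
  simp only [Finset.mem_image]
  rintro _ ⟨a, ha, rfl⟩ _ ⟨b, hb, rfl⟩
  obtain rfl | hab := eq_or_ne a b
  · exact sympForm_self _
  · exact hz _ (h ha hb hab)

end Rankwidth

/-! ### Clique and chromatic numbers of the powers -/

namespace Rankwidth

theorem card_le_chromaticNumber_mul {V : Type*} [Fintype V] (G : SimpleGraph V) {a : ℕ}
    (ha : ∀ S : Finset V, (S : Set V).Pairwise (fun x y => ¬ G.Adj x y) → S.card ≤ a) :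
    Fintype.card V ≤ G.chromaticNumber.toNat * a := by
  classical
  have hcol : G.Colorable (Fintype.card V) := G.colorable_of_fintype
  obtain ⟨c⟩ := SimpleGraph.colorable_chromaticNumber hcol
  have h := Finset.card_le_mul_card_image_of_maps_to (f := c) (s := Finset.univ)
    (t := Finset.univ) (fun _ _ => Finset.mem_univ _) a fun b _ => ha _ ?_
  · rwa [Finset.card_univ, Finset.card_univ, Fintype.card_fin, mul_comm] at h
  · intro x hx y hy _ hxy
    simp only [Finset.coe_filter, Finset.mem_univ, true_and, Set.mem_ofPred_eq] at hx hy
    exact c.valid hxy (hx.trans hy.symm)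

theorem le_card_heapLeaf (M : ℕ) : M ≤ Fintype.card (HeapLeaf M) := by
  have f : Fin M ↪ HeapLeaf M :=
    ⟨fun i => ⟨⟨M + i, by omega⟩, heapTree_degree_of_leaf (Or.inr (Nat.le_add_right M i))⟩,
      fun i j h => by simpa [Fin.ext_iff] using h⟩
  simpa using Fintype.card_le_of_embedding f

instance (M : ℕ) [NeZero M] : Nonempty (HeapLeaf M) :=
  Fintype.card_pos_iff.1 ((Nat.pos_of_neZero M).trans_le (le_card_heapLeaf M))

variable {m : ℕ}

/-- The lexicographic powers of the symplectic graph. -/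
abbrev sympPower (m k : ℕ) : SimpleGraph (HeapLeaf (2 ^ (2 * m * k))) :=
  leafPower (sympGraph m) (2 ^ (2 * m)) (2 ^ (2 * m * k))

theorem rankwidth_sympPower_le (hm : 0 < m) (k : ℕ) :
    rankwidth (sympPower m k) ≤ 2 * m + 1 := by
  refine (rankwidth_leafPower_le _ _ sympGraph_adj_iff_dotProduct (by omega) _).trans_eq ?_
  simp [two_mul]

/-- Labels can need $2mk+1$ bits, one more than `k` digits hold. The additional digit costs only
factors independent of `k`. -/
theorem heapLeaf_lt (hm : 0 < m) {k : ℕ} (v : HeapLeaf (2 ^ (2 * m * k))) :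
    (v.1 : ℕ) < (2 ^ (2 * m)) ^ (k + 1) := by
  refine v.1.2.trans_le ?_
  rw [← pow_succ', ← pow_mul, mul_add, mul_one]
  exact Nat.pow_le_pow_right two_pos (by omega)

theorem val_injective {M : ℕ} : Function.Injective fun v : HeapLeaf M => (v.1 : ℕ) :=
  Fin.val_injective.comp Subtype.val_injective

theorem cliqueNum_sympPower_le (hm : 0 < m) (k : ℕ) :
    (sympPower m k).cliqueNum ≤ (2 * m + 1) ^ (k + 1) := by
  obtain ⟨S, hS⟩ := (sympPower m k).exists_isNClique_cliqueNum
  rw [← hS.card_eq, ← Finset.card_map ⟨_, val_injective⟩]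
  refine lexPower_clique_card_le (by positivity) sympGraph_clique_card_le _ ?_ ?_
  · simp only [Finset.mem_map]
    rintro _ ⟨v, -, rfl⟩
    exact heapLeaf_lt hm v
  · simp only [Finset.coe_map]
    rintro _ ⟨v, hv, rfl⟩ _ ⟨w, hw, rfl⟩ hvw
    exact hS.isClique hv hw fun e => hvw (by rw [e])

theorem one_le_cliqueNum {V : Type*} [Finite V] [Nonempty V] (G : SimpleGraph V) :
    1 ≤ G.cliqueNum := by
  obtain ⟨v⟩ := ‹Nonempty V›
  have h : G.IsClique (({v} : Finset V) : Set V) := by simp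
  simpa using h.card_le_cliqueNum

theorem le_chromaticNumber_sympPower (hm : 0 < m) (k : ℕ) :
    (2 ^ m) ^ k ≤ (sympPower m k).chromaticNumber.toNat * 2 ^ m := by
  have h := (le_card_heapLeaf _).trans
    (card_le_chromaticNumber_mul (sympPower m k) (a := (2 ^ m) ^ (k + 1)) fun S hS => ?_)
  · refine Nat.le_of_mul_le_mul_right (c := (2 ^ m) ^ k) ?_ (by positivity)
    calc (2 ^ m) ^ k * (2 ^ m) ^ k = 2 ^ (2 * m * k) := by ring
      _ ≤ _ := h
      _ = _ := by ring
  · rw [← Finset.card_map ⟨_, val_injective⟩]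
    refine lexPower_indep_card_le (by positivity) sympGraph_indep_card_le _ ?_ ?_
    · simp only [Finset.mem_map]
      rintro _ ⟨v, -, rfl⟩
      exact heapLeaf_lt hm v
    · simp only [Finset.coe_map]
      rintro _ ⟨v, hv, rfl⟩ _ ⟨w, hw, rfl⟩ hvw
      exact hS hv hw fun e => hvw (by rw [e])

/-! ### Comparison of growth rates -/

theorem eval_le_sum_abs_mul_pow (P : ℝ[X]) {x : ℝ} (hx : 1 ≤ x) :
    P.eval x ≤ (∑ i ∈ Finset.range (P.natDegree + 1), |P.coeff i|) * x ^ P.natDegree := by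
  rw [Polynomial.eval_eq_sum_range, Finset.sum_mul]
  refine Finset.sum_le_sum fun i hi => ?_
  have hi' : i ≤ P.natDegree := Nat.lt_succ_iff.1 (Finset.mem_range.1 hi)
  exact mul_le_mul (le_abs_self _) (pow_le_pow_right₀ hx hi') (by positivity) (abs_nonneg _)

theorem le_of_forall_pow_le {a b K : ℝ} (hb : 0 < b)
    (h : ∀ k : ℕ, a ^ k ≤ K * b ^ k) : a ≤ b := by
  by_contra! hlt
  obtain ⟨k, hk⟩ := ((tendsto_pow_atTop_atTop_of_one_lt ((one_lt_div hb).2 hlt)).eventually_gt_atTop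
    K).exists
  rw [div_pow, lt_div_iff₀ (by positivity)] at hk
  exact absurd (h k) (not_le.2 hk)

theorem IsChiBounding.two_pow_le {r : ℕ} {P : ℝ[X]} (hP : IsChiBounding r P) (hm : 0 < m)
    (hr : 2 * m + 1 ≤ r) : (2 : ℝ) ^ m ≤ (2 * m + 1 : ℝ) ^ P.natDegree := by
  set D := P.natDegree
  set C := ∑ i ∈ Finset.range (D + 1), |P.coeff i|
  have hC0 : 0 ≤ C := Finset.sum_nonneg fun i _ => abs_nonneg _
  refine le_of_forall_pow_le (K := C * (2 * m + 1 : ℝ) ^ D * 2 ^ m) (by positivity)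
    fun k => ?_
  have h1 := hP _ (sympPower m k) ((rankwidth_sympPower_le hm k).trans hr)
  have h2 : (1 : ℝ) ≤ (sympPower m k).cliqueNum := by exact_mod_cast one_le_cliqueNum _
  have h3 : ((sympPower m k).cliqueNum : ℝ) ≤ (2 * m + 1) ^ (k + 1) := by
    exact_mod_cast cliqueNum_sympPower_le hm k
  have h4 : ((2 : ℝ) ^ m) ^ k ≤ (sympPower m k).chromaticNumber.toNat * 2 ^ m := by
    exact_mod_cast le_chromaticNumber_sympPower hm k
  calc ((2 : ℝ) ^ m) ^ k ≤ (sympPower m k).chromaticNumber.toNat * 2 ^ m := h4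
    _ ≤ (C * ((2 * m + 1) ^ (k + 1)) ^ D) * 2 ^ m := by
      gcongr
      exact h1.trans ((eval_le_sum_abs_mul_pow P h2).trans (by gcongr))
    _ = C * (2 * m + 1 : ℝ) ^ D * 2 ^ m * ((2 * m + 1 : ℝ) ^ D) ^ k := by
      rw [pow_right_comm, pow_succ]
      ring

theorem IsChiBounding.mul_log_two_le {r : ℕ} {P : ℝ[X]} (hP : IsChiBounding r P) (hr : 3 ≤ r) :
    ((r : ℝ) - 2) / 2 * Real.log 2 ≤ P.natDegree * Real.log r := by
  obtain ⟨m, hm, h1, h2⟩ : ∃ m, 0 < m ∧ 2 * m + 1 ≤ r ∧ r ≤ 2 * m + 2 :=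
    ⟨(r - 1) / 2, by omega, by omega, by omega⟩
  have h1' : (2 * m + 1 : ℝ) ≤ r := by exact_mod_cast h1
  have h2' : (r : ℝ) ≤ 2 * m + 2 := by exact_mod_cast h2
  have h := Real.log_le_log (by positivity) (hP.two_pow_le hm h1)
  rw [Real.log_pow, Real.log_pow] at h
  have hl : Real.log (2 * m + 1) ≤ Real.log r := Real.log_le_log (by positivity) h1'
  have hlog2 : 0 < Real.log 2 := Real.log_pos one_lt_two
  calc ((r : ℝ) - 2) / 2 * Real.log 2 ≤ m * Real.log 2 := by gcongr; linarith
    _ ≤ P.natDegree * Real.log (2 * m + 1) := h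
    _ ≤ _ := by gcongr

theorem eventually_log_le_natDegree :
    ∀ᶠ r : ℕ in atTop, ∀ P : ℝ[X], IsChiBounding r P → Real.log r ≤ P.natDegree := by
  have hlog : ∀ᶠ x : ℝ in atTop, Real.log x ^ 2 ≤ 1 / 8 * x := by
    filter_upwards [(Real.isLittleO_pow_log_id_atTop (n := 2)).bound (c := 1 / 8) (by norm_num),
      eventually_ge_atTop 0] with x hx h0
    simpa [abs_of_nonneg h0] using hx
  filter_upwards [tendsto_natCast_atTop_atTop.eventually hlog, eventually_ge_atTop 4]
    with r hr hr4 P hP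
  have h4 : (4 : ℝ) ≤ r := by exact_mod_cast hr4
  have hpos : 0 < Real.log r := Real.log_pos (by linarith)
  have h := hP.mul_log_two_le (by omega)
  have hlog2 : (1 / 2 : ℝ) ≤ Real.log 2 := by linarith [Real.log_two_gt_d9]
  refine le_of_mul_le_mul_right ?_ hpos
  -- For $r\ge4$, $\frac{r-2}{2}\log 2\ge\frac r4\cdot\frac12=\frac r8\ge\log^2 r$.
  nlinarith

end Rankwidth

theorem mainTheorem9 :
    (∃ c : ℝ, 0 < c ∧ ∀ᶠ r : ℕ in atTop, ∀ P : ℝ[X], Rankwidth.IsChiBounding r P →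
      c * Real.log r ≤ (P.natDegree : ℝ)) ∧
    (∃ o : ℕ → ℝ, Tendsto o atTop (𝓝 0) ∧
      ∀ᶠ r : ℕ in atTop, ∀ P : ℝ[X], Rankwidth.IsChiBounding r P →
        (1 / (2 * Real.log 2) - o r) * Real.log r ≤ (P.natDegree : ℝ)) := by
  -- The degree eventually exceeds $\log r$ itself, so no error term is needed.
  refine ⟨⟨1, one_pos, ?_⟩, ⟨fun _ => 0, tendsto_const_nhds, ?_⟩⟩
  · simpa only [one_mul] using Rankwidth.eventually_log_le_natDegree
  · filter_upwards [Rankwidth.eventually_log_le_natDegree] with r hr P hP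
    refine le_trans ?_ (hr P hP)
    have hc : 1 / (2 * Real.log 2) - 0 ≤ 1 := by
      rw [sub_zero, div_le_one (by positivity)]
      linarith [Real.log_two_gt_d9]
    exact mul_le_of_le_one_left (Real.log_natCast_nonneg r) hc
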